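/- **Chiron.** We use Farmer's set theory Chiron. The expressions of a Chiron language $L$ are the S-expressions built from symbols (including the key words such as $\mathsf{quote}$ and $\mathsf{eval}$) and the operator names of $L$: every atom is an expression, and $(e_1,\dots,e_n)$ with $n\ge 0$ is an expression if the $e_i$ are. The proper expressions are the operators, types, terms and formulas given by Chiron's formation rules. A standard model $M$ of $L$ is based on a model of NBG set theory, whose classes form the domain $D_{\rm c}$; it comes with a choice function on superclasses (collections of classes), an interpretation of the operator names, and a set representing each atom, where distinct atoms have distinct representing sets and these are neither empty nor ordered pairs. The set $D_M$ of values of $M$ consists of the classes, the superclasses, the truth values, the operations and an undefined value $\bot$. For an assignment $\varphi$ into $M$, $V_\varphi$ is Chiron's valuation of expressions (improper expressions get the value $\bot$). In particular $V_\varphi((\mathsf{quote},e))=H(e)$, where $H$ maps each expression to its construction: an atom to its representing set, $()$ to $\emptyset$, and $(e_1,\dots,e_n)$ to the ordered pair $\langle H(e_1),H((e_2,\dots,e_n))\rangle$. An expression is eval-free if the key word $\mathsf{eval}$ does not occur in it. An evaluation $(\mathsf{eval},a,k)$, with $k$ either $\mathsf{type}$, $\mathsf{formula}$ or a type, has the value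 $V_\varphi(e)$ if $V_\varphi(a)=H(e)$ for an eval-free $e$ that is, respectively, a type, a formula, or a term with $V_\varphi(e)\in V_\varphi(k)$; otherwise its value is $D_{\rm c}$, $\mathrm{F}$, $\bot$, respectively. $\mathsf C$ is the type that denotes $D_{\rm c}$. **Syntax frameworks.** An interpreted language is a triple $I=(\mathcal L,D_{\rm sem},V_{\rm sem})$ of a set of expressions, a nonempty set and a total function $V_{\rm sem}:\mathcal L\to D_{\rm sem}$. For $\mathcal L_{\rm obj}\subseteq \mathcal L$, a syntax framework for $(\mathcal L_{\rm obj},I)$ is a tuple $(D_{\rm syn},V_{\rm syn},\mathcal L_{\rm syn},Q,E)$ such that: (1) $D_{\rm syn}\neq\emptyset$ and $V_{\rm syn}:\mathcal L_{\rm obj}\to D_{\rm syn}$ is total and injective; (2) $\mathcal L_{\rm syn}\subseteq \mathcal L$, $D_{\rm syn}\subseteq D_{\rm sem}$, and $V_{\rm sem}$ maps $\mathcal L_{\rm syn}$ into $D_{\rm syn}$; (3) $Q:\mathcal L_{\rm obj}\to \mathcal L_{\rm syn}$ is total and injective with $V_{\rm sem}(Q(e))=V_{\rm syn}(e)$ for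 all $e\in\mathcal L_{\rm obj}$; (4) $E:\mathcal L_{\rm syn}\to \mathcal L_{\rm obj}$ is a (possibly partial) function with $V_{\rm sem}(E(a))=V_{\rm sem}(V_{\rm syn}^{-1}(V_{\rm sem}(a)))$ whenever $E(a)$ is defined (in particular $V_{\rm sem}(a)$ is then in the image of $V_{\rm syn}$). It is replete if $\mathcal L_{\rm obj}=\mathcal L$ and it has built-in quotation and evaluation, that is, every $Q(e)$ is the syntactic result of applying a fixed operator to $e$, and every $E(a)$ that is defined is the syntactic result of applying a fixed operator to $a$ and a parameter ranging over the kinds of expressions ($\mathsf{type}$, $\mathsf{formula}$ and the types). **Theorem.** Let $L$ be a language of Chiron, $\mathcal E_L$ the set of all expressions of $L$, $M$ a standard model for $L$, $\varphi$ an assignment into $M$, and $I=(\mathcal E_L,D_M,V_\varphi)$. Let $D_{\rm syn}$ be the range of $H$, and let $\mathcal T_{\rm syn}$ be the set of terms $a$ with $V_\varphi(a)\in D_{\rm syn}$. Put $Q(e)=(\mathsf{quote},e)$ for $e\in\mathcal E_L$. For $a\in\mathcal T_{\rm syn}$ put $e_a=H^{-1}(V_\varphi(a))$ and 1. $E(a)=(\mathsf{eval},a,\mathsf{type})$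 if $e_a$ is an eval-free type; 2. $E(a)=(\mathsf{eval},a,\mathsf{C})$ if $e_a$ is an eval-free term and $V_\varphi(e_a)\ne\bot$; 3. $E(a)=(\mathsf{eval},a,\mathsf{formula})$ if $e_a$ is an eval-free formula; 4. $E(a)$ is undefined otherwise. Then $(D_{\rm syn},H,\mathcal T_{\rm syn},Q,E)$ is a syntax framework for $(\mathcal E_L,I)$, and it is replete. -/

import Mathlib

universe u v

/-! ## Syntax frameworks

A formal language is a set of expressions taken from a type `X`; semantic values live in a type `Y`.
Functions are total Lean functions, of which only the restriction to the stated set matters. -/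

/-- The data `(L, D_sem, V_sem)` of an interpreted language. -/
structure InterpretedLanguage (X : Type u) (Y : Type v) where
  lang : Set X
  dom : Set Y
  val : X → Y

/-- `D_sem` is nonempty and `V_sem : L → D_sem` is total. -/
def InterpretedLanguage.IsInterpreted {X : Type u} {Y : Type v}
    (I : InterpretedLanguage X Y) : Prop :=
  I.dom.Nonempty ∧ Set.MapsTo I.val I.lang I.dom

/-- `(Dsyn, Vsyn)` is a syntax representation of `Lobj`. -/
def IsSyntaxRepresentation {X : Type u} {Y : Type v} (Lobj : Set X) (Dsyn : Set Y)
    (Vsyn : X → Y) : Prop :=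
  Dsyn.Nonempty ∧ Set.MapsTo Vsyn Lobj Dsyn ∧ Set.InjOn Vsyn Lobj

/-- `(Lsyn, I)` is a syntax language for a syntax representation of `Lobj` with domain `Dsyn`. -/
def IsSyntaxLanguage {X : Type u} {Y : Type v} (Lobj : Set X) (Dsyn : Set Y) (Lsyn : Set X)
    (I : InterpretedLanguage X Y) : Prop :=
  I.IsInterpreted ∧ Lobj ⊆ I.lang ∧ Lsyn ⊆ I.lang ∧ Dsyn ⊆ I.dom ∧ Set.MapsTo I.val Lsyn Dsyn

/-- A tuple `(D_syn, V_syn, L_syn, Q, E)`. The partial function `E` is `Option`-valued. -/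
structure FrameworkTuple (X : Type u) (Y : Type v) where
  Dsyn : Set Y
  Vsyn : X → Y
  Lsyn : Set X
  Q : X → X
  E : X → Option X

/-- `F` is a syntax framework for `(Lobj, I)`. In the evaluation axiom, `e` is
`V_syn⁻¹ (V_sem a)`, which is required to exist whenever `E a` is defined. -/
structure IsSyntaxFramework {X : Type u} {Y : Type v} (Lobj : Set X)
    (I : InterpretedLanguage X Y) (F : FrameworkTuple X Y) : Prop where
  syntaxRepresentation : IsSyntaxRepresentation Lobj F.Dsyn F.Vsyn
  syntaxLanguage : IsSyntaxLanguage Lobj F.Dsyn F.Lsyn I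
  quote_mapsTo : Set.MapsTo F.Q Lobj F.Lsyn
  quote_injOn : Set.InjOn F.Q Lobj
  quotation_axiom : ∀ e ∈ Lobj, I.val (F.Q e) = F.Vsyn e
  eval_mapsTo : ∀ a b, F.E a = some b → a ∈ F.Lsyn ∧ b ∈ Lobj
  evaluation_axiom : ∀ a ∈ F.Lsyn, ∀ b, F.E a = some b →
    ∃ e ∈ Lobj, F.Vsyn e = I.val a ∧ I.val b = I.val e

namespace Chiron

/-! ## Syntax of Chiron -/

/-- The key words. -/
inductive Keyword
  | op | type | term | formula | opApp | var | typeApp | depFunType | funApp | funAbs | cond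
  | exist | defDes | indefDes | quote | eval

/-- The fixed countably infinite set of symbols; the key words are among them. -/
inductive Symbol
  | kw (k : Keyword)
  | name (n : ℕ)

/-- The three sorts from which signature forms are made. -/
inductive SigSort
  | type | term | formula

/-- A signature form `s₁, …, sₙ, sₙ₊₁`. -/
structure Signature where
  args : List SigSort
  res : SigSort

/-- The built-in operator names. -/
inductive BuiltinOp
  | set | cls | opNames | lang | exprSym | exprOpName | expr | exprOp | exprType | exprTerm
  | exprTermType | exprFormula | mem | typeEqual | termEqual | formulaEqual | neg | disj

def BuiltinOp.sig : BuiltinOp → Signature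
  | .set => ⟨[], .type⟩
  | .cls => ⟨[], .type⟩
  | .opNames => ⟨[], .term⟩
  | .lang => ⟨[], .type⟩
  | .exprSym => ⟨[], .type⟩
  | .exprOpName => ⟨[.term], .type⟩
  | .expr => ⟨[.term], .type⟩
  | .exprOp => ⟨[.term], .type⟩
  | .exprType => ⟨[.term], .type⟩
  | .exprTerm => ⟨[.term], .type⟩
  | .exprTermType => ⟨[.term, .term], .type⟩
  | .exprFormula => ⟨[.term], .type⟩
  | .mem => ⟨[.term, .term], .formula⟩
  | .typeEqual => ⟨[.type, .type], .formula⟩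
  | .termEqual => ⟨[.term, .term, .type], .formula⟩
  | .formulaEqual => ⟨[.formula, .formula], .formula⟩
  | .neg => ⟨[.formula], .formula⟩
  | .disj => ⟨[.formula, .formula], .formula⟩

/-- A language of Chiron: its operator names are the built-in ones and those in `ExtraOp`;
every operator name has a signature form, which for built-in names is prescribed. -/
structure Language where
  ExtraOp : Type v
  extraSig : ExtraOp → Signature

/-- The operator names of a language. -/
inductive OpName (L : Language.{v}) : Type v
  | builtin (b : BuiltinOp)
  | extra (o : L.ExtraOp)

def OpName.sig {L : Language.{v}} : OpName L → Signature
  | .builtin b => b.sig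
  | .extra o => L.extraSig o

/-- Atomic expressions: symbols and operator names. -/
inductive Atom (L : Language.{v}) : Type v
  | sym (s : Symbol)
  | opn (o : OpName L)

/-- The expressions of `L`: atomic expressions and finite lists `(e₁, …, eₙ)`, `n ≥ 0`. -/
inductive Expr (L : Language.{v}) : Type v
  | atom (a : Atom L)
  | list (es : List (Expr L))

variable {L : Language.{v}}

namespace Expr

/-- The key word `k` as an expression. -/
def key (k : Keyword) : Expr L := .atom (.sym (.kw k))

/-- The symbol `x` as an expression. -/
def sym (x : Symbol) : Expr L := .atom (.sym x)

/-- The operator name `o` as an expression. -/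
def opn (o : OpName L) : Expr L := .atom (.opn o)

open Classical in
/-- The number of occurrences of the key word `eval` in an expression. -/
noncomputable def evalCount : Expr L → ℕ
  | .atom a => if a = .sym (.kw .eval) then 1 else 0
  | .list [] => 0
  | .list (e :: es) => evalCount e + evalCount (.list es)

/-- An expression is eval-free if `eval` does not occur in it. -/
def EvalFree (e : Expr L) : Prop := e.evalCount = 0

/-- The operator name `o` occurs in an expression. -/
inductive OpOccurs (o : OpName L) : Expr L → Prop
  | atom : OpOccurs o (.atom (.opn o))
  | list {e : Expr L} {es : List (Expr L)} : e ∈ es → OpOccurs o e → OpOccurs o (.list es)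

/-- The expression `(op-app, (op, o, k))` for an operator name `o` without arguments. -/
def const (o : BuiltinOp) (k : Expr L) : Expr L :=
  .list [key .opApp, .list [key .op, opn (.builtin o), k]]

/-- The type `C` of all classes. -/
def typeC : Expr L := const .cls (key .type)

/-- The type of (operator name sets of) languages. -/
def typeLang : Expr L := const .lang (key .type)

/-- The type `E` of the constructions of `L`:
`expr` applied to the constant denoting the set of operator names of `L`. -/
def typeE : Expr L :=
  .list [key .opApp, .list [key .op, opn (.builtin .expr), typeLang, key .type],
    const .opNames typeLang]

end Expr

open Chiron.Expr (key sym opn)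

/-- The kinds `type`, `formula` and `α` (of terms), the last for an expression `α`
that has to be a type. -/
inductive Kind (L : Language.{v}) : Type v
  | type
  | term (α : Expr L)
  | formula

def Kind.sort : Kind L → SigSort
  | .type => .type
  | .term _ => .term
  | .formula => .formula

/-- The expression by which a kind is given inside operators and evaluations. -/
def Kind.toExpr : Kind L → Expr L
  | .type => key .type
  | .term α => α
  | .formula => key .formula

/-- What a proper expression can be: an operator with kinds `k₁, …, kₙ, kₙ₊₁`, or a type, a term
of some type or a formula. -/
inductive Judgment (L : Language.{v}) : Type v
  | operator (ks : List (Kind L)) (k : Kind L)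
  | expr (k : Kind L)

/-- The formation rules for proper expressions. -/
inductive Proper : Expr L → Judgment L → Prop
  | operator (o : OpName L) (ks : List (Kind L)) (k : Kind L)
      (hargs : ks.map Kind.sort = o.sig.args) (hres : k.sort = o.sig.res)
      (htypes : ∀ α, Kind.term α ∈ ks ++ [k] → Proper α (.expr .type)) :
      Proper (.list (key .op :: opn o :: (ks.map Kind.toExpr ++ [k.toExpr]))) (.operator ks k)
  | opApp {O : Expr L} {ks : List (Kind L)} {k : Kind L} (es : List (Expr L))
      (βs : ℕ → Expr L) (hO : Proper O (.operator ks k)) (hlen : es.length = ks.length)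
      (htype : ∀ (i : ℕ) (e : Expr L), es[i]? = some e → ks[i]? = some .type →
        Proper e (.expr .type))
      (hterm : ∀ (i : ℕ) (e α : Expr L), es[i]? = some e → ks[i]? = some (.term α) →
        Proper e (.expr (.term (βs i))))
      (hformula : ∀ (i : ℕ) (e : Expr L), es[i]? = some e → ks[i]? = some .formula →
        Proper e (.expr .formula)) :
      Proper (.list (key .opApp :: O :: es)) (.expr k)
  | var (x : Symbol) {α : Expr L} (hα : Proper α (.expr .type)) :
      Proper (.list [key .var, sym x, α]) (.expr (.term α))
  | typeApp {α a β : Expr L} (hα : Proper α (.expr .type)) (ha : Proper a (.expr (.term β))) :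
      Proper (.list [key .typeApp, α, a]) (.expr .type)
  | depFunType (x : Symbol) {α β : Expr L} (hα : Proper α (.expr .type))
      (hβ : Proper β (.expr .type)) :
      Proper (.list [key .depFunType, .list [key .var, sym x, α], β]) (.expr .type)
  | funApp {f a α β : Expr L} (hf : Proper f (.expr (.term α))) (ha : Proper a (.expr (.term β))) :
      Proper (.list [key .funApp, f, a]) (.expr (.term (.list [key .typeApp, α, a])))
  | funAbs (x : Symbol) {α b β : Expr L} (hα : Proper α (.expr .type))
      (hb : Proper b (.expr (.term β))) :
      Proper (.list [key .funAbs, .list [key .var, sym x, α], b])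
        (.expr (.term (.list [key .depFunType, .list [key .var, sym x, α], β])))
  | condSame {A b c β : Expr L} (hA : Proper A (.expr .formula))
      (hb : Proper b (.expr (.term β))) (hc : Proper c (.expr (.term β))) :
      Proper (.list [key .cond, A, b, c]) (.expr (.term β))
  | condDiff {A b c β γ : Expr L} (hA : Proper A (.expr .formula))
      (hb : Proper b (.expr (.term β))) (hc : Proper c (.expr (.term γ))) (hne : β ≠ γ) :
      Proper (.list [key .cond, A, b, c]) (.expr (.term Expr.typeC))
  | exist (x : Symbol) {α B : Expr L} (hα : Proper α (.expr .type))
      (hB : Proper B (.expr .formula)) :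
      Proper (.list [key .exist, .list [key .var, sym x, α], B]) (.expr .formula)
  | defDes (x : Symbol) {α B : Expr L} (hα : Proper α (.expr .type))
      (hB : Proper B (.expr .formula)) :
      Proper (.list [key .defDes, .list [key .var, sym x, α], B]) (.expr (.term α))
  | indefDes (x : Symbol) {α B : Expr L} (hα : Proper α (.expr .type))
      (hB : Proper B (.expr .formula)) :
      Proper (.list [key .indefDes, .list [key .var, sym x, α], B]) (.expr (.term α))
  | quote (e : Expr L) : Proper (.list [key .quote, e]) (.expr (.term Expr.typeE))
  | eval {a β : Expr L} (k : Kind L) (ha : Proper a (.expr (.term β)))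
      (hk : ∀ α, k = .term α → Proper α (.expr .type)) :
      Proper (.list [key .eval, a, k.toExpr]) (.expr k)

def IsProper (e : Expr L) : Prop := ∃ j, Proper e j
def IsOperator (e : Expr L) : Prop := ∃ ks k, Proper e (.operator ks k)
def IsType (e : Expr L) : Prop := Proper e (.expr .type)
def IsTermOf (e α : Expr L) : Prop := Proper e (.expr (.term α))
def IsTerm (e : Expr L) : Prop := ∃ α, IsTermOf e α
def IsFormula (e : Expr L) : Prop := Proper e (.expr .formula)

/-- The expressions that can serve as the kind `k` in an evaluation `(eval, a, k)`. -/
def IsKind (e : Expr L) : Prop := e = key .type ∨ e = key .formula ∨ IsType e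

/-! ## Set theory -/

section SetTheory

variable {D : Type u} (mem : D → D → Prop)

/-- A set is a class that is a member of a class. -/
def IsSet (x : D) : Prop := ∃ y, mem x y

/-- `x` has no members. -/
def IsEmptyClass (x : D) : Prop := ∀ y, ¬ mem y x

/-- `p = {a, b}` -/
def IsUPair (p a b : D) : Prop := IsSet mem p ∧ ∀ x, mem x p ↔ x = a ∨ x = b

/-- `p` is the (Kuratowski) ordered pair `⟨a, b⟩` of sets. -/
def IsOPair (p a b : D) : Prop :=
  IsSet mem a ∧ IsSet mem b ∧ ∃ s t, IsUPair mem s a a ∧ IsUPair mem t a b ∧ IsUPair mem p s t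

/-- `⟨a, b⟩ ∈ X` -/
def PairMem (a b X : D) : Prop := ∃ p, IsOPair mem p a b ∧ mem p X

/-- `⟨⟨a, b⟩, c⟩ ∈ X` -/
def TripleMem (a b c X : D) : Prop := ∃ p, IsOPair mem p a b ∧ PairMem mem p c X

/-- `f` is a class of ordered pairs that is a function. -/
def IsFunctionClass (f : D) : Prop :=
  (∀ p, mem p f → ∃ a b, IsOPair mem p a b) ∧
  ∀ a b c, PairMem mem a b f → PairMem mem a c f → b = c

/-- `(D, mem)` is a model of von Neumann–Bernays–Gödel set theory (`D` consists of the classes;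
class existence is expressed by the usual finite list of axioms). The axioms of regularity and
choice are not required, so that models of NBG with these axioms are covered as well. -/
structure IsNBG : Prop where
  extensionality : ∀ X Y, (∀ z, mem z X ↔ mem z Y) → X = Y
  pairing : ∀ x y, IsSet mem x → IsSet mem y → ∃ z, IsUPair mem z x y
  null_set : ∃ x, IsSet mem x ∧ IsEmptyClass mem x
  membership : ∃ X, ∀ u v, IsSet mem u → IsSet mem v → (PairMem mem u v X ↔ mem u v)
  intersection : ∀ X Y, ∃ Z, ∀ u, mem u Z ↔ mem u X ∧ mem u Y
  complement : ∀ X, ∃ Z, ∀ u, IsSet mem u → (mem u Z ↔ ¬ mem u X)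
  domain : ∀ X, ∃ Z, ∀ u, IsSet mem u → (mem u Z ↔ ∃ v, PairMem mem u v X)
  product : ∀ X, ∃ Z, ∀ u v, IsSet mem u → IsSet mem v → (PairMem mem u v Z ↔ mem u X)
  rotation : ∀ X, ∃ Z, ∀ u v w, IsSet mem u → IsSet mem v → IsSet mem w →
    (TripleMem mem u v w Z ↔ TripleMem mem v w u X)
  transposition : ∀ X, ∃ Z, ∀ u v w, IsSet mem u → IsSet mem v → IsSet mem w →
    (TripleMem mem u v w Z ↔ TripleMem mem u w v X)
  union : ∀ x, IsSet mem x → ∃ y, IsSet mem y ∧ ∀ u, mem u y ↔ ∃ v, mem u v ∧ mem v x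
  power : ∀ x, IsSet mem x → ∃ y, IsSet mem y ∧
    ∀ u, mem u y ↔ IsSet mem u ∧ ∀ v, mem v u → mem v x
  subsets : ∀ x Y, IsSet mem x → ∃ z, IsSet mem z ∧ ∀ u, mem u z ↔ mem u x ∧ mem u Y
  replacement : ∀ F x, IsSet mem x →
    (∀ a b c, PairMem mem a b F → PairMem mem a c F → b = c) →
    ∃ y, IsSet mem y ∧ ∀ v, mem v y ↔ ∃ u, PairMem mem u v F ∧ mem u x
  infinity : ∃ x, IsSet mem x ∧ (∃ e, IsEmptyClass mem e ∧ mem e x) ∧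
    ∀ u, mem u x → ∃ s, mem s x ∧ ∀ z, mem z s ↔ mem z u ∨ z = u

end SetTheory

/-! ## Values -/

/-- The truth values `T` and `F`. -/
inductive TruthValue : Type u
  | T
  | F

open Classical in
noncomputable def TruthValue.ofProp (p : Prop) : TruthValue.{u} := if p then .T else .F

/-- The values of each sort: superclasses (arbitrary collections of classes) for types, classes or
the undefined value `⊥ = none` for terms, truth values for formulas. -/
@[reducible] def SortVal (D : Type u) : SigSort → Type u
  | .type => Set D
  | .term => Option D
  | .formula => TruthValue.{u}

/-- The operations of a given signature form. -/
@[reducible] def Operation (D : Type u) : List SigSort → SigSort → Type u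
  | [], r => SortVal D r
  | s :: ss, r => SortVal D s → Operation D ss r

/-- The values: classes, the undefined value `⊥`, superclasses, truth values and operations. -/
inductive Val (D : Type u) : Type u
  | cls (d : D)
  | bot
  | sup (σ : Set D)
  | tv (t : TruthValue.{u})
  | oper (s : Signature) (f : Operation D s.args s.res)

namespace Val

variable {D : Type u}

noncomputable def ofSort : (s : SigSort) → SortVal D s → Val D
  | .type, σ => .sup σ
  | .term, none => .bot
  | .term, some d => .cls d
  | .formula, t => .tv t

/-- The value of the given sort for an expression of that sort which is otherwise meaningless:
the superclass of all classes, `⊥`, and `F`, respectively. -/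
noncomputable def default : (s : SigSort) → SortVal D s
  | .type => Set.univ
  | .term => none
  | .formula => .F

/-- A value of the given sort, read back from `Val D`. -/
noncomputable def toSort : (s : SigSort) → Val D → SortVal D s
  | .type, .sup σ => σ
  | .term, .cls d => some d
  | .formula, .tv t => t
  | s, _ => default s

/-- The application of an operation to a list of values. -/
noncomputable def apply : {ss : List SigSort} → {r : SigSort} → Operation D ss r → List (Val D) → SortVal D r
  | [], _, f, _ => f
  | _ :: _, r, _, [] => default r
  | s :: _, _, f, v :: vs => apply (f (toSort s v)) vs

/-- The members of the value of a type. -/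
noncomputable def ext (v : Val D) : Set D := toSort .type v

/-- The value `v` respects a kind whose value is `w`: if the kind is a type, `v` is `⊥` or a member
of that type; the key words `type` and `formula` denote nothing and impose no condition. -/
def Fits (v w : Val D) : Prop :=
  ∀ σ, w = .sup σ → v = .bot ∨ ∃ d ∈ σ, v = .cls d

/-- The values `vs` respect, one by one, the kinds whose values are `ws`. -/
def FitAll (vs ws : List (Val D)) : Prop := List.Forall₂ Fits vs ws

end Val

/-! ## Standard models -/

/-- A standard model for `L`: a model `(D, mem)` of NBG, a choice function on superclasses, the
constructions of the atomic expressions (distinct sets, neither empty nor ordered pairs) and the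
interpretation of the operator names that are not built in. -/
structure StandardModel (L : Language.{v}) where
  D : Type u
  mem : D → D → Prop
  nbg : IsNBG mem
  choice : Set D → D
  choice_mem : ∀ σ : Set D, σ.Nonempty → choice σ ∈ σ
  atomVal : Atom L → D
  atomVal_injective : Function.Injective atomVal
  atomVal_isSet : ∀ a, IsSet mem (atomVal a)
  atomVal_not_empty : ∀ a, ¬ IsEmptyClass mem (atomVal a)
  atomVal_not_pair : ∀ a x y, ¬ IsOPair mem (atomVal a) x y
  extraInterp : (o : L.ExtraOp) → Operation D (L.extraSig o).args (L.extraSig o).res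

namespace Expr

theorem evalCount_le_of_mem {e : Expr L} {es : List (Expr L)} (h : e ∈ es) :
    e.evalCount ≤ (Expr.list es).evalCount := by
  induction es with
  | nil => simp at h
  | cons a as ih =>
    rw [evalCount]
    rcases List.mem_cons.1 h with rfl | h
    · omega
    · have := ih h
      omega

/-- The order in which expressions are evaluated. -/
theorem lex_of_mem {e : Expr L} {es : List (Expr L)} (h : e ∈ es) :
    Prod.Lex (· < ·) (· < ·) (e.evalCount, sizeOf e) ((Expr.list es).evalCount, sizeOf (Expr.list es)) := by
  have h1 := evalCount_le_of_mem h
  have h2 := List.sizeOf_lt_of_mem h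
  rcases Nat.lt_or_eq_of_le h1 with h1 | h1
  · exact Prod.Lex.left _ _ h1
  · rw [h1]
    refine Prod.Lex.right _ ?_
    simp only [Expr.list.sizeOf_spec]
    omega

theorem lex_of_mem_mem {e : Expr L} {es fs : List (Expr L)} (h : e ∈ es) (h' : .list es ∈ fs) :
    Prod.Lex (· < ·) (· < ·) (e.evalCount, sizeOf e)
      ((Expr.list fs).evalCount, sizeOf (Expr.list fs)) :=
  _root_.trans (r := Prod.Lex (· < ·) (· < ·)) (lex_of_mem h) (lex_of_mem h')

theorem lex_of_evalFree {e : Expr L} {es : List (Expr L)} (h : e.EvalFree) :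
    Prod.Lex (· < ·) (· < ·) (e.evalCount, sizeOf e)
      ((Expr.list (.atom (.sym (.kw .eval)) :: es)).evalCount,
        sizeOf (Expr.list (.atom (.sym (.kw .eval)) :: es))) := by
  refine Prod.Lex.left _ _ ?_
  rw [show e.evalCount = 0 from h, evalCount, evalCount, if_pos rfl]
  omega

end Expr

namespace StandardModel

variable (M : StandardModel.{u, v} L)

instance : Nonempty M.D := ⟨M.nbg.null_set.choose⟩

/-- The empty set of the model. -/
noncomputable def emptySet : M.D :=
  Classical.epsilon fun x => IsSet M.mem x ∧ IsEmptyClass M.mem x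

/-- The ordered pair `⟨a, b⟩` of the model. -/
noncomputable def opair (a b : M.D) : M.D := Classical.epsilon fun p => IsOPair M.mem p a b

/-- The function `H`, which maps each expression to the construction representing it:
`H (()) = ∅` and `H ((e₁, …, eₙ)) = ⟨H e₁, H ((e₂, …, eₙ))⟩`. -/
noncomputable def H : Expr L → M.D
  | .atom a => M.atomVal a
  | .list [] => M.emptySet
  | .list (e :: es) => M.opair (H e) (H (.list es))

/-- The constructions that represent operator names. -/
def opNameConstructions : Set M.D := {d | ∃ o : OpName L, d = M.H (opn o)}

/-- The sets of constructions of operator names. -/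
def langs : Set M.D := {a | IsSet M.mem a ∧ ∀ x, M.mem x a → x ∈ M.opNameConstructions}

/-- The constructions that represent an expression which satisfies `P` and whose operator names
are all given by the set `a`. -/
def constructionsIn (a : M.D) (P : Expr L → Prop) : Set M.D :=
  {d | ∃ e, d = M.H e ∧ P e ∧ ∀ o, e.OpOccurs o → M.mem (M.H (opn o)) a}

open Classical in
/-- The superclass of the `constructionsIn a P` if `a` is in `langs`, and the superclass of all
classes otherwise. -/
noncomputable def exprsOver (a : Option M.D) (P : Expr L → Prop) : Set M.D :=
  match a with
  | none => Set.univ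
  | some a => if a ∈ M.langs then M.constructionsIn a P else Set.univ

open Classical in
/-- The operations assigned to the built-in operator names. -/
noncomputable def builtinInterp : (b : BuiltinOp) → Operation M.D b.sig.args b.sig.res
  | .set => ({d | IsSet M.mem d} : Set M.D)
  | .cls => (Set.univ : Set M.D)
  | .opNames => (if h : ∃ c, ∀ x, M.mem x c ↔ x ∈ M.opNameConstructions then some h.choose else none :
      Option M.D)
  | .lang => M.langs
  | .exprSym => ({d | ∃ s : Symbol, d = M.H (sym s)} : Set M.D)
  | .exprOpName => fun a => M.exprsOver a fun e => ∃ o, e = opn o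
  | .expr => fun a => M.exprsOver a fun _ => True
  | .exprOp => fun a => M.exprsOver a IsOperator
  | .exprType => fun a => M.exprsOver a IsType
  | .exprTerm => fun a => M.exprsOver a IsTerm
  | .exprTermType => fun a (b : Option M.D) =>
      (if ∃ α, b = some (M.H α) ∧ IsType α ∧ M.H α ∈ M.exprsOver a IsType then
        M.exprsOver a fun e => ∃ α, b = some (M.H α) ∧ IsTermOf e α
      else Set.univ : Set M.D)
  | .exprFormula => fun a => M.exprsOver a IsFormula
  | .mem => fun a b => TruthValue.ofProp (∃ x y, a = some x ∧ b = some y ∧ M.mem x y)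
  | .typeEqual => fun σ τ => TruthValue.ofProp (σ = τ)
  | .termEqual => fun a b σ => TruthValue.ofProp (∃ x ∈ σ, a = some x ∧ b = some x)
  | .formulaEqual => fun s t => TruthValue.ofProp (s = t)
  | .neg => fun t => TruthValue.ofProp (t = .F)
  | .disj => fun s t => TruthValue.ofProp (s = .T ∨ t = .T)

/-- The operation assigned to an operator name. -/
noncomputable def interp : (o : OpName L) → Operation M.D o.sig.args o.sig.res
  | .builtin b => M.builtinInterp b
  | .extra o => M.extraInterp o

/-! ## Valuation -/

/-- The assignments into `M`. -/
def Assignment : Type u := Symbol → M.D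

variable {M}

open Classical in
/-- The assignment `φ[x ↦ d]`. -/
noncomputable def Assignment.update (φ : M.Assignment) (x : Symbol) (d : M.D) : M.Assignment :=
  fun y => if y = x then d else φ y

variable (M)

open Classical in
/-- `H⁻¹`, undefined at values that are not constructions. -/
noncomputable def Hinv (v : Val M.D) : Option (Expr L) :=
  if h : ∃ e, v = .cls (M.H e) then some h.choose else none

open Classical in
/-- The semantic clauses. They are applied to proper expressions only (see `val`). The recursion
is on the number of occurrences of `eval` and then on the size of the expression. -/
noncomputable def clause : Expr L → M.Assignment → Val M.D
  -- operator `(op, o, k₁, …, kₙ₊₁)`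
  | .list (.atom (.sym (.kw .op)) :: .atom (.opn o) :: _), _ => .oper o.sig (M.interp o)
  -- operator application `(op-app, (op, o, k₁, …, kₙ, kₙ₊₁), e₁, …, eₙ)`
  | .list (.atom (.sym (.kw .opApp)) ::
      .list (.atom (.sym (.kw .op)) :: .atom (.opn o) :: ks) :: es), φ =>
    let kinds := ks.attach.map fun k => clause k.1 φ
    let vs := es.attach.map fun e => clause e.1 φ
    let r := Val.apply (M.interp o) vs
    if Val.FitAll (vs ++ [Val.ofSort o.sig.res r]) kinds then
      Val.ofSort o.sig.res r
    else Val.ofSort o.sig.res (Val.default o.sig.res)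
  -- variable `(var, x, α)`
  | .list [.atom (.sym (.kw .var)), .atom (.sym x), α], φ =>
    if φ x ∈ (clause α φ).ext then .cls (φ x) else .bot
  -- type application `(type-app, α, a)`
  | .list [.atom (.sym (.kw .typeApp)), α, a], φ =>
    match clause a φ with
    | .cls d => .sup {y | ∃ f ∈ (clause α φ).ext, IsFunctionClass M.mem f ∧ PairMem M.mem d y f}
    | _ => .sup Set.univ
  -- dependent function type `(dep-fun-type, (var, x, α), β)`
  | .list [.atom (.sym (.kw .depFunType)),
      .list [.atom (.sym (.kw .var)), .atom (.sym x), α], β], φ =>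
    .sup {f | IsFunctionClass M.mem f ∧ ∀ d y, PairMem M.mem d y f →
      d ∈ (clause α φ).ext ∧ y ∈ (clause β (φ.update x d)).ext}
  -- function application `(fun-app, f, a)`
  | .list [.atom (.sym (.kw .funApp)), f, a], φ =>
    if h : ∃ g d y, clause f φ = .cls g ∧ clause a φ = .cls d ∧ IsFunctionClass M.mem g ∧
      PairMem M.mem d y g then .cls h.choose_spec.choose_spec.choose else .bot
  -- function abstraction `(fun-abs, (var, x, α), b)`
  | .list [.atom (.sym (.kw .funAbs)),
      .list [.atom (.sym (.kw .var)), .atom (.sym x), α], b], φ =>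
    if h : ∃ g, IsFunctionClass M.mem g ∧ ∀ d y, PairMem M.mem d y g ↔
      IsSet M.mem d ∧ d ∈ (clause α φ).ext ∧ IsSet M.mem y ∧ clause b (φ.update x d) = .cls y
    then .cls h.choose else .bot
  -- conditional term `(if, A, b, c)`
  | .list [.atom (.sym (.kw .cond)), A, b, c], φ =>
    if clause A φ = .tv .T then clause b φ else clause c φ
  -- existential quantification `(exists, (var, x, α), B)`
  | .list [.atom (.sym (.kw .exist)),
      .list [.atom (.sym (.kw .var)), .atom (.sym x), α], B], φ =>
    .tv (TruthValue.ofProp (∃ d ∈ (clause α φ).ext, clause B (φ.update x d) = .tv .T))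
  -- definite description `(def-des, (var, x, α), B)`
  | .list [.atom (.sym (.kw .defDes)),
      .list [.atom (.sym (.kw .var)), .atom (.sym x), α], B], φ =>
    if h : ∃! d, d ∈ (clause α φ).ext ∧ clause B (φ.update x d) = .tv .T then .cls h.choose
    else .bot
  -- indefinite description `(indef-des, (var, x, α), B)`
  | .list [.atom (.sym (.kw .indefDes)),
      .list [.atom (.sym (.kw .var)), .atom (.sym x), α], B], φ =>
    if {d | d ∈ (clause α φ).ext ∧ clause B (φ.update x d) = .tv .T}.Nonempty then
      .cls (M.choice {d | d ∈ (clause α φ).ext ∧ clause B (φ.update x d) = .tv .T})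
    else .bot
  -- quotation `(quote, e)`
  | .list [.atom (.sym (.kw .quote)), e], _ => .cls (M.H e)
  -- evaluation `(eval, a, type)`
  | .list [.atom (.sym (.kw .eval)), a, .atom (.sym (.kw .type))], φ =>
    match M.Hinv (clause a φ) with
    | some e => if _h : e.EvalFree ∧ IsType e then clause e φ else .sup Set.univ
    | none => .sup Set.univ
  -- evaluation `(eval, a, formula)`
  | .list [.atom (.sym (.kw .eval)), a, .atom (.sym (.kw .formula))], φ =>
    match M.Hinv (clause a φ) with
    | some e => if _h : e.EvalFree ∧ IsFormula e then clause e φ else .tv .F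
    | none => .tv .F
  -- evaluation `(eval, a, α)` for a type `α`
  | .list [.atom (.sym (.kw .eval)), a, α], φ =>
    match M.Hinv (clause a φ) with
    | some e =>
      if _h : e.EvalFree ∧ IsTerm e then
        if ∃ d ∈ (clause α φ).ext, clause e φ = .cls d then clause e φ else .bot
      else .bot
    | none => .bot
  | _, _ => .bot
termination_by e => (e.evalCount, sizeOf e)
decreasing_by
  all_goals first
    | exact Expr.lex_of_evalFree (And.left (by assumption))
    | (apply Expr.lex_of_mem; simp; done)
    | exact Expr.lex_of_mem (List.mem_cons_of_mem _ (List.mem_cons_of_mem _ (Subtype.property _)))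
    | (exact Expr.lex_of_mem_mem (es := [_, _, _])
        (.tail _ (.tail _ (.head _))) (.tail _ (.head _)))
    | exact Expr.lex_of_mem_mem
        (List.mem_cons_of_mem _ (List.mem_cons_of_mem _ (Subtype.property _))) (.tail _ (.head _))

open Classical in
/-- The valuation function `V_φ`, total on expressions: improper expressions denote nothing, so
they are given the undefined value `⊥`. -/
noncomputable def val (φ : M.Assignment) (e : Expr L) : Val M.D :=
  if IsProper e then M.clause e φ else .bot

/-! ## The framework -/

/-- The interpreted language `(E_L, D_M, V_φ)`, where `E_L` consists of all expressions of `L`. -/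
noncomputable def interpretedLanguage (φ : M.Assignment) :
    InterpretedLanguage (Expr L) (Val M.D) where
  lang := Set.univ
  dom := Set.univ
  val := M.val φ

/-- `D_syn`, the range of `H`. -/
def Dsyn : Set (Val M.D) := {v | ∃ e, v = .cls (M.H e)}

/-- `T_syn`, the set of terms that denote constructions. -/
def Tsyn (φ : M.Assignment) : Set (Expr L) := {a | IsTerm a ∧ M.val φ a ∈ M.Dsyn}

open Classical in
/-- The partial evaluation function `E` on `T_syn`. -/
noncomputable def E (φ : M.Assignment) (a : Expr L) : Option (Expr L) :=
  if a ∈ M.Tsyn φ then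
    match M.Hinv (M.val φ a) with
    | some e =>
      if IsType e ∧ e.EvalFree then some (.list [key .eval, a, key .type])
      else if IsTerm e ∧ e.EvalFree ∧ M.val φ e ≠ .bot then
        some (.list [key .eval, a, Expr.typeC])
      else if IsFormula e ∧ e.EvalFree then some (.list [key .eval, a, key .formula])
      else none
    | none => none
  else none

/-- The tuple `(D_syn, H, T_syn, Q, E)` with `Q e = (quote, e)`. -/
noncomputable def framework (φ : M.Assignment) : FrameworkTuple (Expr L) (Val M.D) where
  Dsyn := M.Dsyn
  Vsyn := fun e => .cls (M.H e)
  Lsyn := M.Tsyn φ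
  Q := fun e => .list [key .quote, e]
  E := M.E φ

end StandardModel

/-! ## Replete syntax frameworks -/

/-- Built-in quotation: there is an operator (a key word) such that every quotation is the
syntactic result of applying it to the quoted expression. -/
def HasBuiltInQuotation {Y : Type u} (Lobj : Set (Expr L))
    (F : FrameworkTuple (Expr L) Y) : Prop :=
  ∃ q : Keyword, ∀ e ∈ Lobj, F.Q e = .list [key q, e]

/-- Built-in evaluation: there is an operator (a key word) such that every evaluation `E a` that is
defined is the syntactic result of applying it to `a` and to a parameter that ranges over the
kinds of expressions (the language being typed). -/
def HasBuiltInEvaluation {Y : Type u} (F : FrameworkTuple (Expr L) Y) : Prop :=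
  ∃ q : Keyword, ∀ a ∈ F.Lsyn, ∀ b, F.E a = some b → ∃ k, IsKind k ∧ b = .list [key q, a, k]

/-- `F` is replete: its object language is the full language, and it has built-in quotation and
built-in evaluation. -/
def IsReplete {Y : Type u} (Lobj : Set (Expr L)) (I : InterpretedLanguage (Expr L) Y)
    (F : FrameworkTuple (Expr L) Y) : Prop :=
  Lobj = I.lang ∧ HasBuiltInQuotation Lobj F ∧ HasBuiltInEvaluation F

end Chiron

/-! Two facts carry the theorem. The first is that `H` is injective. Constructions come in three
mutually exclusive forms: representing sets of atoms, the empty set, and ordered pairs. Representing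
sets are distinct, and a Kuratowski pair determines its components, so an expression can be read
back from its construction by recursion (`H_injective`). Hence `Hinv` really inverts `H`, and
quotation satisfies its axiom directly by the clause for `quote`.

The second is that evaluation returns the value of the denoted expression `e` once the kind is
chosen to suit `e`. For types and formulas the guard of the clause is precisely what the definition
of `E` has tested. For terms the clause also demands that the value of `e` be a class in the value
of the kind. Every term denotes a class or `⊥` (`isTermVal_clause`), and `C` denotes all classes, so
a term that does not denote `⊥` passes (`clause_eval_typeC`). `E_eq_some` collects the three cases;
the other conditions are immediate from the definitions. -/

namespace Chiron

/-! ### Kuratowski pairs -/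

section SetTheory

variable {D : Type u} {mem : D → D → Prop}

theorem IsUPair.left_mem {p a b : D} (h : IsUPair mem p a b) : mem a p := (h.2 a).2 (.inl rfl)

theorem IsUPair.right_mem {p a b : D} (h : IsUPair mem p a b) : mem b p := (h.2 b).2 (.inr rfl)

theorem IsOPair.isSet {p a b : D} (h : IsOPair mem p a b) : IsSet mem p := by
  obtain ⟨-, -, s, t, -, -, h⟩ := h
  exact h.1

theorem IsOPair.not_empty {p a b : D} (h : IsOPair mem p a b) : ¬ IsEmptyClass mem p := by
  obtain ⟨-, -, s, t, -, -, h⟩ := h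
  exact fun h' => h' s h.left_mem

theorem IsNBG.exists_isOPair (h : IsNBG mem) {a b : D} (ha : IsSet mem a) (hb : IsSet mem b) :
    ∃ p, IsOPair mem p a b := by
  obtain ⟨s, hs⟩ := h.pairing a a ha ha
  obtain ⟨t, ht⟩ := h.pairing a b ha hb
  obtain ⟨p, hp⟩ := h.pairing s t hs.1 ht.1
  exact ⟨p, ha, hb, s, t, hs, ht, hp⟩

/-- The usual comparison of `{{a}, {a, b}}` with `{{a'}, {a', b'}}`. It uses membership conditions
only, so extensionality is not needed. -/
theorem IsOPair.injective {p a b a' b' : D} (h : IsOPair mem p a b) (h' : IsOPair mem p a' b') :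
    a = a' ∧ b = b' := by
  obtain ⟨-, -, s, t, hs, ht, hp⟩ := h
  obtain ⟨-, -, s', t', hs', ht', hp'⟩ := h'
  have ha : a = a' := by
    rcases (hp.2 s').1 hp'.left_mem with rfl | rfl
    · exact ((hs.2 a').1 hs'.left_mem).elim Eq.symm Eq.symm
    · exact ((hs'.2 a).1 ht.left_mem).elim id id
  subst ha
  refine ⟨rfl, ?_⟩
  have hb := (hp'.2 t).1 hp.right_mem
  have hb' := (hp.2 t').1 hp'.right_mem
  have h1 := ht.right_mem
  have h2 := ht'.right_mem
  -- If `{a, b}` is the singleton `{a}`, the pair is degenerate and both second components equal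
  -- `a`. Otherwise `{a, b}` and `{a, b'}` are the same set.
  rcases hb with rfl | rfl
  · have e1 : b = a := ((hs'.2 b).1 h1).elim id id
    rcases hb' with rfl | rfl
    · exact e1.trans ((hs.2 b').1 h2 |>.elim id id).symm
    · exact e1.trans ((hs'.2 b').1 h2 |>.elim id id).symm
  · rcases (ht'.2 b).1 h1 with rfl | rfl
    · exact ((ht.2 b').1 h2 |>.elim id id).symm
    · rfl

end SetTheory

open Chiron.Expr (key sym opn)

variable {L : Language.{v}}

/-! ### Constructions and the injectivity of `H` -/

namespace StandardModel

variable (M : StandardModel.{u, v} L)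

theorem emptySet_spec : IsSet M.mem M.emptySet ∧ IsEmptyClass M.mem M.emptySet :=
  Classical.epsilon_spec M.nbg.null_set

theorem isOPair_opair {a b : M.D} (ha : IsSet M.mem a) (hb : IsSet M.mem b) :
    IsOPair M.mem (M.opair a b) a b :=
  Classical.epsilon_spec (M.nbg.exists_isOPair ha hb)

/-- `opair` is picked by `epsilon` and is known to be an ordered pair only when both components are
sets, so sethood has to travel along the recursion. -/
theorem isSet_H : ∀ e : Expr L, IsSet M.mem (M.H e)
  | .atom a => by rw [H]; exact M.atomVal_isSet a
  | .list [] => by rw [H]; exact M.emptySet_spec.1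
  | .list (e :: es) => by
    rw [H]
    exact (M.isOPair_opair (isSet_H e) (isSet_H (.list es))).isSet

theorem isOPair_H_cons (e : Expr L) (es : List (Expr L)) :
    IsOPair M.mem (M.H (.list (e :: es))) (M.H e) (M.H (.list es)) := by
  rw [H]
  exact M.isOPair_opair (M.isSet_H e) (M.isSet_H (.list es))

/-- Mixed cases are impossible because representing sets of atoms are neither empty nor pairs, and
pairs are nonempty. Two nonempty lists are compared by head and tail. -/
theorem H_injective_aux : ∀ e e' : Expr L, M.H e = M.H e' → e = e'
  | .atom a, .atom b, h => by
    rw [H, H] at h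
    rw [M.atomVal_injective h]
  | .atom a, .list [], h => by
    rw [H, H] at h
    exact absurd (h ▸ M.emptySet_spec.2) (M.atomVal_not_empty a)
  | .atom a, .list (e :: es), h => by
    have := M.isOPair_H_cons e es
    rw [← h, H] at this
    exact absurd this (M.atomVal_not_pair a _ _)
  | .list [], .atom a, h => by
    rw [H, H] at h
    exact absurd (h ▸ M.emptySet_spec.2) (M.atomVal_not_empty a)
  | .list [], .list [], _ => rfl
  | .list [], .list (e :: es), h => by
    have := (M.isOPair_H_cons e es).not_empty
    rw [← h, H] at this
    exact absurd M.emptySet_spec.2 this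
  | .list (e :: es), .atom a, h => by
    have := M.isOPair_H_cons e es
    rw [h, H] at this
    exact absurd this (M.atomVal_not_pair a _ _)
  | .list (e :: es), .list [], h => by
    have := (M.isOPair_H_cons e es).not_empty
    rw [h, H] at this
    exact absurd M.emptySet_spec.2 this
  | .list (e :: es), .list (e' :: es'), h => by
    obtain ⟨h1, h2⟩ := (M.isOPair_H_cons e es).injective (h ▸ M.isOPair_H_cons e' es')
    have h3 := H_injective_aux e e' h1
    have h4 := H_injective_aux (.list es) (.list es') h2
    rw [h3, Expr.list.inj h4]

theorem H_injective : Function.Injective M.H := fun e e' => M.H_injective_aux e e'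

/-- `Hinv` chooses some preimage; injectivity leaves only one. -/
theorem Hinv_cls_H (e : Expr L) : M.Hinv (.cls (M.H e)) = some e := by
  have h : ∃ e', Val.cls (M.H e) = .cls (M.H e') := ⟨e, rfl⟩
  rw [Hinv, dif_pos h]
  exact congrArg some (M.H_injective (Val.cls.inj h.choose_spec)).symm

end StandardModel

/-! ### Formation of quotations and evaluations -/

theorem IsProper.of_isType {e : Expr L} (h : IsType e) : IsProper e := ⟨_, h⟩

theorem IsProper.of_isTerm {e : Expr L} (h : IsTerm e) : IsProper e := ⟨_, h.choose_spec⟩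

theorem IsProper.of_isFormula {e : Expr L} (h : IsFormula e) : IsProper e := ⟨_, h⟩

/-- Every proper expression is a compound expression. -/
theorem Proper.not_atom {a : Atom L} {j : Judgment L} : ¬ Proper (.atom a) j := by
  intro h
  cases h

theorem isType_typeC : IsType (Expr.typeC : Expr L) := by
  -- There are no arguments, so the function giving their types is arbitrary.
  refine Proper.opApp (O := .list [key .op, opn (.builtin .cls), key .type]) (ks := []) []
    (fun _ => Expr.typeC) ?_ rfl ?_ ?_ ?_
  · exact Proper.operator (.builtin .cls) [] .type rfl rfl (by simp)
  all_goals simp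

theorem isTerm_quote (e : Expr L) : IsTerm (.list [key .quote, e]) := ⟨_, Proper.quote e⟩

theorem IsTerm.isType_eval {a : Expr L} (h : IsTerm a) :
    IsType (.list [key .eval, a, key .type]) :=
  Proper.eval .type h.choose_spec (by simp)

theorem IsTerm.isFormula_eval {a : Expr L} (h : IsTerm a) :
    IsFormula (.list [key .eval, a, key .formula]) :=
  Proper.eval .formula h.choose_spec (by simp)

theorem IsTerm.isTerm_eval {a α : Expr L} (h : IsTerm a) (hα : IsType α) :
    IsTerm (.list [key .eval, a, α]) :=
  ⟨α, Proper.eval (.term α) h.choose_spec (by rintro _ ⟨⟩; exact hα)⟩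

/-! ### Values of terms -/

namespace Val

variable {D : Type u}

/-- The values of terms: classes and the undefined value. -/
def IsTermVal (v : Val D) : Prop := v = .bot ∨ ∃ d, v = .cls d

theorem isTermVal_bot : IsTermVal (.bot : Val D) := .inl rfl

theorem isTermVal_cls (d : D) : IsTermVal (.cls d) := .inr ⟨d, rfl⟩

theorem isTermVal_ofSort {s : SigSort} (h : s = .term) (x : SortVal D s) :
    IsTermVal (ofSort s x) := by
  subst h
  rcases x with _ | d
  · exact isTermVal_bot
  · exact isTermVal_cls d

end Val

/-! ### Valuation of quotations and evaluations -/

namespace StandardModel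

variable (M : StandardModel.{u, v} L) (φ : M.Assignment)

theorem val_of_isProper {e : Expr L} (h : IsProper e) : M.val φ e = M.clause e φ := if_pos h

theorem clause_quote (e : Expr L) : M.clause (.list [key .quote, e]) φ = .cls (M.H e) := by
  simp only [key, clause]

theorem clause_eval_type {a e : Expr L} (h : M.clause a φ = .cls (M.H e)) (hf : e.EvalFree)
    (he : IsType e) : M.clause (.list [key .eval, a, key .type]) φ = M.clause e φ := by
  simp only [key, clause, h, Hinv_cls_H]
  rw [dif_pos ⟨hf, he⟩]

theorem clause_eval_formula {a e : Expr L} (h : M.clause a φ = .cls (M.H e)) (hf : e.EvalFree)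
    (he : IsFormula e) : M.clause (.list [key .eval, a, key .formula]) φ = M.clause e φ := by
  simp only [key, clause, h, Hinv_cls_H]
  rw [dif_pos ⟨hf, he⟩]

theorem clause_typeC : M.clause (Expr.typeC : Expr L) φ = .sup Set.univ := by
  rw [Expr.typeC, Expr.const, key, key, opn, clause]
  -- Whether or not the fitting condition holds is irrelevant: the default value of a type is also
  -- the superclass of all classes.
  split_ifs <;> rfl

open Classical in
theorem clause_eval_term (a : Expr L) {α : Expr L} (hα : IsType α) :
    M.clause (.list [key .eval, a, α]) φ =
      match M.Hinv (M.clause a φ) with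
      | some e =>
        if e.EvalFree ∧ IsTerm e then
          if ∃ d ∈ (M.clause α φ).ext, M.clause e φ = .cls d then M.clause e φ else .bot
        else .bot
      | none => .bot := by
  rw [key, clause]
  -- The dependent `if` in `clause` serves only its termination proof.
  · rfl
  -- The clause for a type parameter applies only after the key words `type` and `formula` are
  -- excluded; these are atoms, and a type is not.
  · rintro rfl; exact Proper.not_atom hα
  · rintro rfl; exact Proper.not_atom hα

/-- Nearly every clause for a term produces a class or `⊥` by its form alone. Only conditionals,
which pass on the value of a branch, need the induction hypothesis. -/
theorem isTermVal_clause {e : Expr L} {j : Judgment L} (h : Proper e j) :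
    ∀ α, j = .expr (.term α) → ∀ φ, (M.clause e φ).IsTermVal := by
  induction h with
  | operator => rintro α ⟨⟩
  | opApp es βs hO =>
    rintro α ⟨⟩ φ
    -- Inverting the formation of the operator exposes its name, which `clause` matches on, and
    -- shows that its result sort is that of terms.
    cases hO with
    | operator o ks k hargs hres htypes =>
      simp only [key, opn, clause]
      split_ifs <;> exact Val.isTermVal_ofSort hres.symm _
  | var x hα =>
    rintro α ⟨⟩ φ
    simp only [key, sym, clause]
    split_ifs
    · exact Val.isTermVal_cls _
    · exact Val.isTermVal_bot
  | typeApp => rintro α ⟨⟩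
  | depFunType => rintro α ⟨⟩
  | funApp =>
    rintro α ⟨⟩ φ
    simp only [key, clause]
    split_ifs
    · exact Val.isTermVal_cls _
    · exact Val.isTermVal_bot
  | funAbs =>
    rintro α ⟨⟩ φ
    simp only [key, sym, clause]
    split_ifs
    · exact Val.isTermVal_cls _
    · exact Val.isTermVal_bot
  | condSame hA hb hc ihA ihb ihc =>
    rintro α ⟨⟩ φ
    simp only [key, clause]
    split_ifs
    · exact ihb _ rfl φ
    · exact ihc _ rfl φ
  | condDiff hA hb hc hne ihA ihb ihc =>
    rintro α ⟨⟩ φ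
    simp only [key, clause]
    split_ifs
    · exact ihb _ rfl φ
    · exact ihc _ rfl φ
  | exist => rintro α ⟨⟩
  | defDes =>
    rintro α ⟨⟩ φ
    simp only [key, sym, clause]
    split_ifs
    · exact Val.isTermVal_cls _
    · exact Val.isTermVal_bot
  | indefDes =>
    rintro α ⟨⟩ φ
    simp only [key, sym, clause]
    split_ifs
    · exact Val.isTermVal_cls _
    · exact Val.isTermVal_bot
  | quote e =>
    rintro α ⟨⟩ φ
    rw [clause_quote]
    exact Val.isTermVal_cls _
  | eval k ha hk =>
    rintro α ⟨⟩ φ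
    -- The denoted expression need not be a subexpression, so no induction hypothesis covers it; the
    -- guard of the clause itself forces its value to be a class.
    rw [Kind.toExpr, M.clause_eval_term φ _ (hk α rfl)]
    split
    · split_ifs with h1 h2
      · obtain ⟨d, -, h⟩ := h2
        exact .inr ⟨d, h⟩
      · exact Val.isTermVal_bot
      · exact Val.isTermVal_bot
    · exact Val.isTermVal_bot

/-! ### The quotation and evaluation functions of the framework -/

theorem clause_eval_typeC {a e : Expr L} (h : M.clause a φ = .cls (M.H e)) (hf : e.EvalFree)
    (he : IsTerm e) (hb : M.clause e φ ≠ .bot) :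
    M.clause (.list [key .eval, a, Expr.typeC]) φ = M.clause e φ := by
  obtain ⟨β, hβ⟩ := he
  obtain ⟨d, hd⟩ := (M.isTermVal_clause hβ β rfl φ).resolve_left hb
  rw [clause_eval_term M φ a isType_typeC, h, Hinv_cls_H]
  dsimp only
  rw [if_pos ⟨hf, β, hβ⟩, if_pos]
  refine ⟨d, ?_, hd⟩
  rw [clause_typeC]
  exact Set.mem_univ d

theorem quote_mem_Tsyn (e : Expr L) : .list [key .quote, e] ∈ M.Tsyn φ :=
  ⟨isTerm_quote e, e, by
    rw [val_of_isProper M φ (.of_isTerm (isTerm_quote e)), clause_quote]⟩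

/-- Where `E` is defined, its value is an evaluation with a kind as its parameter, and it has the
value of the expression whose construction is denoted by the argument. -/
theorem E_eq_some {a b : Expr L} (h : M.E φ a = some b) :
    a ∈ M.Tsyn φ ∧ (∃ k, IsKind k ∧ b = .list [key .eval, a, k]) ∧
      ∃ e, .cls (M.H e) = M.val φ a ∧ M.val φ b = M.val φ e := by
  rw [E] at h
  split_ifs at h with ha
  obtain ⟨hterm, e, he⟩ := ha
  refine ⟨⟨hterm, e, he⟩, ?_⟩
  rw [he, Hinv_cls_H] at h
  have hc : M.clause a φ = .cls (M.H e) := by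
    rw [← he, val_of_isProper M φ (.of_isTerm hterm)]
  dsimp only at h
  -- The three branches left are the defining cases of `E`: type, term, formula.
  split_ifs at h with h1 h2 h3 <;> cases h
  · refine ⟨⟨_, .inl rfl, rfl⟩, e, he.symm, ?_⟩
    rw [val_of_isProper M φ (.of_isType hterm.isType_eval),
      val_of_isProper M φ (.of_isType h1.1), M.clause_eval_type φ hc h1.2 h1.1]
  · refine ⟨⟨_, .inr (.inr isType_typeC), rfl⟩, e, he.symm, ?_⟩
    have hv := val_of_isProper M φ (.of_isTerm h2.1)
    rw [val_of_isProper M φ (.of_isTerm (hterm.isTerm_eval isType_typeC)), hv,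
      M.clause_eval_typeC φ hc h2.2.1 h2.1 (hv ▸ h2.2.2)]
  · refine ⟨⟨_, .inr (.inl rfl), rfl⟩, e, he.symm, ?_⟩
    rw [val_of_isProper M φ (.of_isFormula hterm.isFormula_eval),
      val_of_isProper M φ (.of_isFormula h3.1), M.clause_eval_formula φ hc h3.2 h3.1]

end StandardModel

end Chiron

/-! ### Assembly of the framework -/

theorem theorem2 (L : Chiron.Language.{v}) (M : Chiron.StandardModel.{u, v} L)
    (φ : M.Assignment) :
    IsSyntaxFramework (Set.univ : Set (Chiron.Expr L)) (M.interpretedLanguage φ) (M.framework φ) ∧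
      Chiron.IsReplete (Set.univ : Set (Chiron.Expr L)) (M.interpretedLanguage φ)
        (M.framework φ) := by
  -- The empty expression and `⊥` witness that the syntactic and semantic domains are nonempty.
  -- `Tsyn` is mapped into `Dsyn` by its definition.
  refine ⟨⟨⟨⟨_, .list [], rfl⟩, fun e _ => ⟨e, rfl⟩, ?_⟩, ⟨⟨⟨.bot, trivial⟩, fun _ _ => trivial⟩,
    fun _ _ => trivial, fun _ _ => trivial, fun _ _ => trivial, fun a ha => ha.2⟩,
    fun e _ => M.quote_mem_Tsyn φ e, ?_, ?_, ?_, ?_⟩, rfl, ⟨.quote, fun _ _ => rfl⟩, .eval, ?_⟩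
  · exact fun e _ e' _ h => M.H_injective (Chiron.Val.cls.inj h)
  · intro e _ e' _ h
    simpa using Chiron.Expr.list.inj h
  · intro e _
    exact (M.val_of_isProper φ (.of_isTerm (Chiron.isTerm_quote e))).trans (M.clause_quote φ e)
  · exact fun a b h => ⟨(M.E_eq_some φ h).1, trivial⟩
  · intro a _ b h
    obtain ⟨e, h1, h2⟩ := (M.E_eq_some φ h).2.2
    exact ⟨e, trivial, h1, h2⟩
  · exact fun a _ b h => (M.E_eq_some φ h).2.1
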